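/- Let $n\ge 1$ and $q\ge 1$ be integers, and let $M,K\in\mathbb{R}^{n\times n}$ be symmetric positive definite. For $i,j\in\{1,\dots,q\}$ let $D_{ij},R_{ij}\in\mathbb{R}^{n\times n}$ be symmetric positive semidefinite with $D_{ij}=D_{ji}$, $R_{ij}=R_{ji}$, $D_{ii}=R_{ii}=0$. Consider the array of $q$ coupled oscillators $$M\ddot x_i+Kx_i+\sum_{j=1}^{q}D_{ij}(\dot x_i-\dot x_j)+\sum_{j=1}^{q}R_{ij}(x_i-x_j)=0,\qquad i=1,\dots,q,$$ with $x_i(t)\in\mathbb{R}^n$. The array is said to synchronize if $\|x_i(t)-x_j(t)\|\to 0$ as $t\to\infty$ for all $i,j$ and for all solutions (that is, for all initial conditions). Put $P=M^{-1/2}KM^{-1/2}$ and assume that the eigenvalues of $P$ are distinct. For a symmetric family of symmetric positive semidefinite weights $W_{ij}\in\mathbb{R}^{n\times n}$ with $W_{ii}=0$ let $\mathrm{lap}(W_{ij})\in\mathbb{R}^{qn\times qn}$ denote the block matrix with diagonal blocks $\sum_{j}W_{ij}$ and off-diagonal blocks $-W_{ij}$, and put $$L_d=\mathrm{lap}(M^{-1/2}D_{ij}M^{-1/2}),\qquad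 L_r=\mathrm{lap}(M^{-1/2}R_{ij}M^{-1/2}),\qquad \Gamma=L_d+\mathrm{j}\,(I_q\otimes P+L_r)\in\mathbb{C}^{qn\times qn},$$ where $\mathrm{j}$ is the imaginary unit. Let $\lambda_1(\Gamma),\dots,\lambda_{qn}(\Gamma)$ be the eigenvalues of $\Gamma$, listed with algebraic multiplicity in any order such that $\mathrm{Re}\,\lambda_1(\Gamma)\le\dots\le\mathrm{Re}\,\lambda_{qn}(\Gamma)$. Then: 1. If $q\ge 2$ (so that $\lambda_{n+1}(\Gamma)$ exists), the array synchronizes if and only if $\mathrm{Re}\,\lambda_{n+1}(\Gamma)>0$. 2. The array synchronizes if and only if $\Gamma$ has exactly $n$ eigenvalues on the imaginary axis, counted with algebraic multiplicity. -/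

import Mathlib

open Filter Topology Matrix
open scoped Kronecker MatrixOrder

namespace SmallOscillations

noncomputable section

/-- The array of `q` coupled oscillators
`M ẍᵢ + K xᵢ + ∑ⱼ Dᵢⱼ (ẋᵢ - ẋⱼ) + ∑ⱼ Rᵢⱼ (xᵢ - xⱼ) = 0`, `i = 1, …, q`:
`x` is a (twice differentiable) solution of it. -/
def IsSolution {n q : ℕ} (M K : Matrix (Fin n) (Fin n) ℝ)
    (D R : Fin q → Fin q → Matrix (Fin n) (Fin n) ℝ)
    (x : Fin q → ℝ → (Fin n → ℝ)) : Prop :=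
  (∀ i, Differentiable ℝ (x i)) ∧
  (∀ i, Differentiable ℝ (deriv (x i))) ∧
  ∀ i t, M *ᵥ deriv (deriv (x i)) t + K *ᵥ x i t
    + ∑ j, D i j *ᵥ (deriv (x i) t - deriv (x j) t)
    + ∑ j, R i j *ᵥ (x i t - x j t) = 0

/-- The array synchronizes: for every solution, hence for all initial conditions,
the Euclidean norm of `xᵢ(t) - xⱼ(t)` tends to `0` as `t → ∞`, for all `i`, `j`. -/
def Synchronizes {n q : ℕ} (M K : Matrix (Fin n) (Fin n) ℝ)
    (D R : Fin q → Fin q → Matrix (Fin n) (Fin n) ℝ) : Prop :=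
  ∀ x : Fin q → ℝ → (Fin n → ℝ), IsSolution M K D R x →
    ∀ i j, Tendsto (fun t => ‖WithLp.toLp 2 (x i t - x j t)‖) atTop (𝓝 0)

/-- `M ^ (-1/2)`, the inverse of the positive semidefinite square root of `M`. -/
def invSqrt {n : ℕ} (M : Matrix (Fin n) (Fin n) ℝ) : Matrix (Fin n) (Fin n) ℝ :=
  (CFC.sqrt M)⁻¹

/-- `P = M ^ (-1/2) K M ^ (-1/2)`. -/
def matP {n : ℕ} (M K : Matrix (Fin n) (Fin n) ℝ) : Matrix (Fin n) (Fin n) ℝ :=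
  invSqrt M * K * invSqrt M

/-- The matrix-weighted Laplacian: the block matrix with diagonal blocks `∑ⱼ Wᵢⱼ`
and off-diagonal blocks `-Wᵢⱼ`. -/
def lap {n q : ℕ} (W : Fin q → Fin q → Matrix (Fin n) (Fin n) ℝ) :
    Matrix (Fin q × Fin n) (Fin q × Fin n) ℝ :=
  Matrix.of fun a b =>
    if a.1 = b.1 then (∑ j, W a.1 j) a.2 b.2 else -(W a.1 b.1 a.2 b.2)

/-- The Laplacian of the coupling `W` in the coordinates `zᵢ = M ^ (1/2) xᵢ`. -/
def couplingLap {n q : ℕ} (M : Matrix (Fin n) (Fin n) ℝ)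
    (W : Fin q → Fin q → Matrix (Fin n) (Fin n) ℝ) :
    Matrix (Fin q × Fin n) (Fin q × Fin n) ℝ :=
  lap fun i j => invSqrt M * W i j * invSqrt M

/-- `Γ = L_d + j (I_q ⊗ P + L_r)`, where `j` is the imaginary unit. -/
def matGamma {n q : ℕ} (M K : Matrix (Fin n) (Fin n) ℝ)
    (D R : Fin q → Fin q → Matrix (Fin n) (Fin n) ℝ) :
    Matrix (Fin q × Fin n) (Fin q × Fin n) ℂ :=
  (couplingLap M D).map Complex.ofReal +
    Complex.I • ((1 : Matrix (Fin q) (Fin q) ℝ) ⊗ₖ matP M K + couplingLap M R).map Complex.ofReal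

/-- `lam` lists the eigenvalues of `X`, with algebraic multiplicity, by nondecreasing real part;
`lam 0` is the first one. -/
def IsEigenvalueOrdering {ι : Type*} [Fintype ι] [DecidableEq ι] (X : Matrix ι ι ℂ)
    (lam : Fin (Fintype.card ι) → ℂ) : Prop :=
  Finset.univ.val.map lam = X.charpoly.roots ∧ Monotone fun k => (lam k).re

/-- Number of eigenvalues of `X` on the imaginary axis, with algebraic multiplicity. -/
def imagAxisCount {ι : Type*} [Fintype ι] [DecidableEq ι] (X : Matrix ι ι ℂ) : ℕ :=
  X.charpoly.roots.countP fun z => z.re = 0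

end

/-- Every complex matrix has such a listing of its eigenvalues. -/
theorem exists_isEigenvalueOrdering {ι : Type*} [Fintype ι] [DecidableEq ι] (X : Matrix ι ι ℂ) :
    ∃ lam, IsEigenvalueOrdering X lam := by
  have hc : X.charpoly.roots.toList.length = Fintype.card ι := by
    rw [Multiset.length_toList, IsAlgClosed.card_roots_eq_natDegree,
      Matrix.charpoly_natDegree_eq_dim]
  let f : Fin (Fintype.card ι) → ℂ := fun k => X.charpoly.roots.toList.get (Fin.cast hc.symm k)
  have hf : Finset.univ.val.map f = X.charpoly.roots := by
    have h1 : List.ofFn f = X.charpoly.roots.toList := by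
      apply List.ext_getElem
      · simp [hc]
      · intro i h1 h2
        simp [f]
    have h2 := congrArg (fun l : List ℂ => (l : Multiset ℂ)) h1
    simpa [Fin.univ_val_map] using h2
  refine ⟨f ∘ Tuple.sort (fun k => (f k).re), ?_, Tuple.monotone_sort (fun k => (f k).re)⟩
  rw [← hf, ← Multiset.map_map]
  congr 1
  exact congrArg Finset.val (Finset.map_univ_equiv (Tuple.sort fun k => (f k).re))

/-- For `n ≥ 1` and `q ≥ 2` a `qn × qn` matrix has an `(n+1)`-st eigenvalue. -/
theorem lt_card_prod {n q : ℕ} (hn : 1 ≤ n) (hq : 2 ≤ q) :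
    n < Fintype.card (Fin q × Fin n) := by
  simp only [Fintype.card_prod, Fintype.card_fin]
  nlinarith

end SmallOscillations

/-! In the coordinates `z_i = M^{1/2} x_i` the array reads `z'' + A z + L z' = 0` with `A = I ⊗ P +
L_r` positive definite and `L = L_d` positive semidefinite, and `Γ = L + jA`. Both sides of the
equivalence are compared with one condition: every real `v` with `L v = 0` and `A v = μ v` (an
undamped mode) has equal blocks.

Dynamics: a mode with unequal blocks gives a cosine solution that never synchronizes. Conversely,
the energy `|z'|² + z·Az` decreases at rate `2 z'·Lz'`, so by LaSalle the limit trajectories satisfy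
`L z' = 0` at all times (`tendsto_zero_of_damped_oscillator`). Their velocities form an
`A`-invariant subspace of `ker L`, which is spanned by undamped modes since `A` is symmetric.

Spectrum: the real part of `v*Γv = z|v|²` is `v*Lv ≥ 0`, so the spectrum lies in the closed right
half-plane, and `Re z = 0` forces `L v = 0` and `A v = -jz v`. Such eigenvalues are semisimple, so
their algebraic count is the dimension of the complex span of the undamped modes. That span contains
the `n`-dimensional synchronous space, and the count is `n` exactly when the two coincide
(`imagAxisCount_eq_iff`). Sorting by real part turns this into the condition on `λ_{n+1}`. -/

namespace SmallOscillations

/-! ### Linear flows and LaSalle's principle -/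

section LaSalle

variable {F H : Type*} [NormedAddCommGroup F] [NormedSpace ℝ F] [CompleteSpace F]

theorem hasDerivAt_exp_smul_apply (B : F →L[ℝ] F) (y : F) (t : ℝ) :
    HasDerivAt (fun s : ℝ => NormedSpace.exp (s • B) y) (B (NormedSpace.exp (t • B) y)) t :=
  by simpa using (hasDerivAt_exp_smul_const' B t).clm_apply (hasDerivAt_const t y)

theorem eq_exp_smul_apply {B : F →L[ℝ] F} {y : ℝ → F} (hy : ∀ t, HasDerivAt y (B (y t)) t)
    (t s : ℝ) : y (t + s) = NormedSpace.exp (s • B) (y t) := by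
  have h : (fun s => y (t + s)) = fun s : ℝ => NormedSpace.exp (s • B) (y t) := by
    refine ODE_solution_unique_univ (v := fun _ => B) (s := fun _ => Set.univ) (t₀ := 0)
      (fun _ => B.lipschitz.lipschitzOnWith) (fun u => ⟨?_, trivial⟩)
      (fun u => ⟨hasDerivAt_exp_smul_apply B (y t) u, trivial⟩) (by simp)
    exact (hy (t + u)).comp_const_add t u
  exact congrFun h s

/-- LaSalle's invariance principle for a linear equation `y' = B y`: along a relatively compact
trajectory on which `e` converges to `c`, every continuous function `G` vanishing on the
trajectories with `e` constantly equal to `c` tends to `0`. -/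
theorem tendsto_zero_of_constant_trajectories [TopologicalSpace H] [Zero H]
    {B : F →L[ℝ] F} {y : ℝ → F} (hy : ∀ t, HasDerivAt y (B (y t)) t)
    {S : Set F} (hS : IsCompact S) (hyS : ∀ᶠ t in atTop, y t ∈ S)
    {e : F → ℝ} (he : Continuous e) {c : ℝ} (hc : Tendsto (fun t => e (y t)) atTop (𝓝 c))
    {G : F → H} (hG : Continuous G)
    (h0 : ∀ y₀, (∀ s : ℝ, e (NormedSpace.exp (s • B) y₀) = c) → G y₀ = 0) :
    Tendsto (fun t => G (y t)) atTop (𝓝 0) := by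
  -- Along any ultrafilter finer than `atTop`, compactness yields a limit point `y₀`. Time shifts do
  -- not change the limit of `e`, so `e` equals `c` along the whole trajectory of `y₀`.
  rw [tendsto_iff_ultrafilter]
  intro g hg
  obtain ⟨y₀, -, hy₀⟩ := hS.ultrafilter_le_nhds (g.map y) (by
    rw [le_principal_iff]
    exact hg hyS)
  have hlim : Tendsto y g (𝓝 y₀) := hy₀
  have : G y₀ = 0 := by
    refine h0 y₀ fun s => ?_
    have h1 : Tendsto (fun t => e (y (t + s))) g (𝓝 c) :=
      (hc.comp (tendsto_atTop_add_const_right atTop s tendsto_id)).mono_left hg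
    have h2 : Tendsto (fun t => e (y (t + s))) g (𝓝 (e (NormedSpace.exp (s • B) y₀))) := by
      simp_rw [eq_exp_smul_apply hy _ s]
      exact ((he.comp (NormedSpace.exp (s • B)).continuous).tendsto y₀).comp hlim
    exact tendsto_nhds_unique h2 h1
  rw [← this]
  exact (hG.tendsto y₀).comp hlim

end LaSalle

/-- The sublevel sets of a positive definite, continuous, homogeneous quadratic function are
bounded. -/
theorem exists_norm_le_of_quadratic_le {F : Type*} [NormedAddCommGroup F] [NormedSpace ℝ F]
    [FiniteDimensional ℝ F] {e : F → ℝ} (he : Continuous e)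
    (hsmul : ∀ (a : ℝ) (y : F), e (a • y) = a ^ 2 * e y) (hpos : ∀ y, y ≠ 0 → 0 < e y) (c : ℝ) :
    ∃ r, ∀ y, e y ≤ c → ‖y‖ ≤ r := by
  rcases (Metric.sphere (0 : F) 1).eq_empty_or_nonempty with h | h
  · refine ⟨0, fun y _ => ?_⟩
    by_contra! hy
    have : (‖y‖⁻¹ • y) ∈ Metric.sphere (0 : F) 1 := by
      simp [norm_smul, inv_mul_cancel₀ hy.ne']
    simp [h] at this
  · obtain ⟨u, hu, hmin⟩ := (isCompact_sphere (0 : F) 1).exists_isMinOn h he.continuousOn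
    have hm : 0 < e u := hpos u (by rintro rfl; simp at hu)
    -- The summand 1 ensures `‖y‖ > 1`, hence `‖y‖ ≤ ‖y‖ ^ 2`, which avoids a square root in the
    -- radius.
    refine ⟨|c| / e u + 1, fun y hyc => ?_⟩
    by_contra! hy
    have hc : 0 ≤ |c| / e u := by positivity
    have hy1 : 1 < ‖y‖ := by linarith
    have hy0 : 0 < ‖y‖ := by linarith
    have h1 : e u ≤ e (‖y‖⁻¹ • y) := hmin (by simp [norm_smul, inv_mul_cancel₀ hy0.ne'])
    rw [hsmul, inv_pow, inv_mul_eq_div, le_div_iff₀ (by positivity)] at h1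
    have h2 : |c| < e u * ‖y‖ := by
      rw [mul_comm, ← div_lt_iff₀ hm]; linarith
    have h3 : e u * ‖y‖ ≤ e u * ‖y‖ ^ 2 := by
      apply mul_le_mul_of_nonneg_left _ hm.le
      nlinarith
    linarith [le_abs_self c]

/-! ### Damped second-order systems -/

section SecondOrder

variable {ι : Type*} [Fintype ι]

/-- The generator `(z, v) ↦ (v, -A z - L v)` of the first-order system of `z'' + A z + L z' = 0`. -/
noncomputable def oscillatorGenerator (A L : Matrix ι ι ℝ) :
    ((ι → ℝ) × (ι → ℝ)) →L[ℝ] (ι → ℝ) × (ι → ℝ) :=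
  LinearMap.toContinuousLinearMap
    ((LinearMap.snd ℝ (ι → ℝ) (ι → ℝ)).prod
      (-(A.mulVecLin ∘ₗ LinearMap.fst ℝ _ _) - L.mulVecLin ∘ₗ LinearMap.snd ℝ _ _))

@[simp] theorem oscillatorGenerator_apply (A L : Matrix ι ι ℝ) (y : (ι → ℝ) × (ι → ℝ)) :
    oscillatorGenerator A L y = (y.2, -(A *ᵥ y.1) - L *ᵥ y.2) := rfl

/-- Twice the energy of the state `(z, v)`. -/
def oscillatorEnergy (A : Matrix ι ι ℝ) (y : (ι → ℝ) × (ι → ℝ)) : ℝ :=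
  y.2 ⬝ᵥ y.2 + y.1 ⬝ᵥ (A *ᵥ y.1)

theorem continuous_oscillatorEnergy (A : Matrix ι ι ℝ) : Continuous (oscillatorEnergy A) := by
  unfold oscillatorEnergy
  fun_prop

theorem hasDerivAt_dotProduct {u v : ℝ → ι → ℝ} {u' v' : ι → ℝ} {t : ℝ} (hu : HasDerivAt u u' t)
    (hv : HasDerivAt v v' t) :
    HasDerivAt (fun s => u s ⬝ᵥ v s) (u' ⬝ᵥ v t + u t ⬝ᵥ v') t := by
  simp only [dotProduct, ← Finset.sum_add_distrib]
  exact HasDerivAt.fun_sum fun i _ =>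
    (hasDerivAt_pi.1 hu i).mul (hasDerivAt_pi.1 hv i)

theorem hasDerivAt_mulVec {κ : Type*} [Finite κ] (A : Matrix κ ι ℝ) {u : ℝ → ι → ℝ} {u' : ι → ℝ}
    {t : ℝ} (hu : HasDerivAt u u' t) : HasDerivAt (fun s => A *ᵥ u s) (A *ᵥ u') t := by
  have := Fintype.ofFinite κ
  exact (LinearMap.toContinuousLinearMap A.mulVecLin).hasFDerivAt.comp_hasDerivAt t hu

theorem dotProduct_mulVec_comm_of_isHermitian {A : Matrix ι ι ℝ} (hA : A.IsHermitian)
    (u v : ι → ℝ) : u ⬝ᵥ (A *ᵥ v) = v ⬝ᵥ (A *ᵥ u) := by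
  have hT : Aᵀ = A := by
    rw [← conjTranspose_eq_transpose_of_trivial]; exact hA
  rw [dotProduct_mulVec, ← mulVec_transpose, hT, dotProduct_comm]

theorem hasDerivAt_oscillatorEnergy {A L : Matrix ι ι ℝ} (hA : A.IsHermitian)
    {y : ℝ → (ι → ℝ) × (ι → ℝ)} {t : ℝ}
    (hy : HasDerivAt y (oscillatorGenerator A L (y t)) t) :
    HasDerivAt (fun s => oscillatorEnergy A (y s)) (-2 * ((y t).2 ⬝ᵥ (L *ᵥ (y t).2))) t := by
  have h1 : HasDerivAt (fun s => (y s).1) (y t).2 t := hy.fst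
  have h2 : HasDerivAt (fun s => (y s).2) (-(A *ᵥ (y t).1) - L *ᵥ (y t).2) t := hy.snd
  refine ((hasDerivAt_dotProduct h2 h2).add
    (hasDerivAt_dotProduct h1 (hasDerivAt_mulVec A h1))).congr_deriv ?_
  rw [dotProduct_comm _ ((y t).2), dotProduct_mulVec_comm_of_isHermitian hA (y t).1 (y t).2]
  simp only [dotProduct_sub, dotProduct_neg]
  ring

/-- The states whose velocity remains in the kernel of `L` for all times. -/
noncomputable def undampedStates (A L : Matrix ι ι ℝ) : Submodule ℝ ((ι → ℝ) × (ι → ℝ)) :=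
  ⨅ s : ℝ, LinearMap.ker (L.mulVecLin ∘ₗ LinearMap.snd ℝ _ _ ∘ₗ
    (NormedSpace.exp (s • oscillatorGenerator A L)).toLinearMap)

theorem mem_undampedStates {A L : Matrix ι ι ℝ} {y : (ι → ℝ) × (ι → ℝ)} :
    y ∈ undampedStates A L ↔
      ∀ s : ℝ, L *ᵥ (NormedSpace.exp (s • oscillatorGenerator A L) y).2 = 0 := by
  simp [undampedStates]

theorem mulVec_snd_eq_zero_of_mem_undampedStates {A L : Matrix ι ι ℝ}
    {y : (ι → ℝ) × (ι → ℝ)} (hy : y ∈ undampedStates A L) : L *ᵥ y.2 = 0 := by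
  simpa using mem_undampedStates.1 hy 0

/-- The generator commutes with its flow, so differentiating `L v(s) = 0` in `s` shows that it
preserves these states; on them its damping term vanishes. -/
theorem undampedStates_invariant {A L : Matrix ι ι ℝ} {y : (ι → ℝ) × (ι → ℝ)}
    (hy : y ∈ undampedStates A L) : (y.2, -(A *ᵥ y.1)) ∈ undampedStates A L := by
  have h0 : (y.2, -(A *ᵥ y.1)) = oscillatorGenerator A L y := by
    simp [mulVec_snd_eq_zero_of_mem_undampedStates hy]
  rw [h0, mem_undampedStates]
  intro s
  have hcomm : NormedSpace.exp (s • oscillatorGenerator A L) (oscillatorGenerator A L y) =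
      oscillatorGenerator A L (NormedSpace.exp (s • oscillatorGenerator A L) y) := by
    have : Commute (NormedSpace.exp (s • oscillatorGenerator A L)) (oscillatorGenerator A L) :=
      (((Commute.refl (oscillatorGenerator A L)).smul_left s)).exp_left
    exact DFunLike.congr_fun this.eq y
  have h1 : HasDerivAt (fun s : ℝ => (NormedSpace.exp (s • oscillatorGenerator A L) y).2)
      (oscillatorGenerator A L (NormedSpace.exp (s • oscillatorGenerator A L) y)).2 s :=
    (hasDerivAt_exp_smul_apply _ y s).snd
  have h2 := hasDerivAt_mulVec L h1
  simp_rw [mem_undampedStates.1 hy] at h2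
  rw [hcomm]
  exact h2.unique (hasDerivAt_const s 0)

variable [DecidableEq ι]

/-- Applying the generator twice turns a velocity `v` into `-A v`, so the velocities of undamped
states form an admissible `V`. For positions, `-A y.1` is again such a velocity, and `A`, injective
on the finite-dimensional `V`, maps `V` onto itself; hence `y.1 ∈ V`. -/
theorem fst_mem_of_mem_undampedStates {A L : Matrix ι ι ℝ} (hA : A.PosDef)
    {U : Submodule ℝ (ι → ℝ)}
    (hU : ∀ V : Submodule ℝ (ι → ℝ), (∀ v ∈ V, A *ᵥ v ∈ V) → (∀ v ∈ V, L *ᵥ v = 0) → V ≤ U)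
    {y : (ι → ℝ) × (ι → ℝ)} (hy : y ∈ undampedStates A L) : y.1 ∈ U := by
  set V := (undampedStates A L).map (LinearMap.snd ℝ (ι → ℝ) (ι → ℝ)) with hV
  have hinv : ∀ v ∈ V, A *ᵥ v ∈ V := by
    rintro _ ⟨w, hw, rfl⟩
    refine ⟨_, (undampedStates A L).neg_mem
      (undampedStates_invariant (undampedStates_invariant hw)), ?_⟩
    simp
  refine hU V hinv ?_ ?_
  · rintro _ ⟨w, hw, rfl⟩
    exact mulVec_snd_eq_zero_of_mem_undampedStates hw
  · have hinj : Function.Injective (A.mulVecLin.restrict hinv) := by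
      intro u v h
      apply Subtype.ext
      exact Matrix.mulVec_injective_of_isUnit hA.isUnit (congrArg Subtype.val h)
    obtain ⟨v, hv⟩ := LinearMap.surjective_of_injective hinj
      ⟨A *ᵥ y.1, by
        have := V.neg_mem (Submodule.mem_map_of_mem (f := LinearMap.snd ℝ (ι → ℝ) (ι → ℝ))
          (undampedStates_invariant hy))
        simpa using this⟩
    have : (v : ι → ℝ) = y.1 :=
      Matrix.mulVec_injective_of_isUnit hA.isUnit (congrArg Subtype.val hv)
    exact this ▸ v.2

/-- Every trajectory of a damped oscillator approaches the subspace `U` as soon as `U` contains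
every stiffness-invariant subspace of undamped directions. -/
theorem tendsto_zero_of_damped_oscillator {A L : Matrix ι ι ℝ} (hA : A.PosDef)
    (hL : L.PosSemidef) {U : Submodule ℝ (ι → ℝ)}
    (hU : ∀ V : Submodule ℝ (ι → ℝ), (∀ v ∈ V, A *ᵥ v ∈ V) → (∀ v ∈ V, L *ᵥ v = 0) → V ≤ U)
    {z v : ℝ → ι → ℝ} (hz : ∀ t, HasDerivAt z (v t) t)
    (hv : ∀ t, HasDerivAt v (-(A *ᵥ z t) - L *ᵥ v t) t)
    {H : Type*} [TopologicalSpace H] [Zero H] {G : (ι → ℝ) → H} (hG : Continuous G)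
    (hGU : ∀ u ∈ U, G u = 0) :
    Tendsto (fun t => G (z t)) atTop (𝓝 0) := by
  have hy : ∀ t, HasDerivAt (fun s => (z s, v s)) (oscillatorGenerator A L (z t, v t)) t :=
    fun t => (hz t).prodMk (hv t)
  have hLnn : ∀ u, 0 ≤ u ⬝ᵥ (L *ᵥ u) := fun u => by
    simpa using hL.dotProduct_mulVec_nonneg u
  have hAnn : ∀ u, 0 ≤ u ⬝ᵥ (A *ᵥ u) := fun u => by
    simpa using hA.posSemidef.dotProduct_mulVec_nonneg u
  have hvv : ∀ u : ι → ℝ, 0 ≤ u ⬝ᵥ u := fun u => by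
    simpa using dotProduct_star_self_nonneg u
  have hanti : Antitone fun t => oscillatorEnergy A (z t, v t) :=
    antitone_of_hasDerivAt_nonpos (fun t => hasDerivAt_oscillatorEnergy hA.1 (hy t))
      fun t => by
        have := hLnn (v t)
        simp only [Pi.zero_apply]
        linarith
  have hlim := tendsto_atTop_ciInf hanti ⟨0, by
    rintro _ ⟨t, rfl⟩
    exact add_nonneg (hvv _) (hAnn _)⟩
  obtain ⟨r, hr⟩ := exists_norm_le_of_quadratic_le (continuous_oscillatorEnergy A)
    (fun a y => by
      simp only [oscillatorEnergy, Prod.smul_fst, Prod.smul_snd, mulVec_smul, dotProduct_smul,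
        smul_dotProduct, smul_eq_mul]
      ring)
    (fun y hy => by
      by_cases h1 : y.1 = 0
      · have h2 : y.2 ≠ 0 := fun h2 => hy (Prod.ext h1 h2)
        have : 0 < y.2 ⬝ᵥ y.2 := by simpa using dotProduct_star_self_pos_iff.2 h2
        exact add_pos_of_pos_of_nonneg this (hAnn _)
      · have : 0 < y.1 ⬝ᵥ (A *ᵥ y.1) := by simpa using hA.dotProduct_mulVec_pos h1
        exact add_pos_of_nonneg_of_pos (hvv _) this)
    (oscillatorEnergy A (z 0, v 0))
  refine tendsto_zero_of_constant_trajectories hy (isCompact_closedBall 0 r)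
    ((eventually_ge_atTop 0).mono fun t ht => ?_) (continuous_oscillatorEnergy A) hlim
    (hG.comp continuous_fst) fun y₀ h0 => ?_
  · simpa using hr _ (hanti ht)
  · refine hGU _ (fst_mem_of_mem_undampedStates hA hU (mem_undampedStates.2 fun s => ?_))
    -- Constant energy forces `v·Lv = 0`, and semidefiniteness upgrades this to `L v = 0`.
    have h1 := hasDerivAt_oscillatorEnergy (L := L) hA.1
      (hasDerivAt_exp_smul_apply (oscillatorGenerator A L) y₀ s)
    simp_rw [h0] at h1
    have h2 := h1.unique (hasDerivAt_const s _)
    rw [← hL.dotProduct_mulVec_zero_iff]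
    simpa using h2

end SecondOrder

end SmallOscillations

/-! ### Eigenvalues of `L + jA` on the imaginary axis -/

namespace SmallOscillations

open scoped ComplexOrder

section Hermitian

variable {𝕜 ι : Type*} [RCLike 𝕜] [Fintype ι]

theorem im_eq_zero_of_mulVec_eq_smul {A : Matrix ι ι ℂ} (hA : A.IsHermitian) {v : ι → ℂ}
    (hv : v ≠ 0) {μ : ℂ} (h : A *ᵥ v = μ • v) : μ.im = 0 := by
  have h1 := hA.im_star_dotProduct_mulVec_self v
  have h2 : 0 < star v ⬝ᵥ v := dotProduct_star_self_pos_iff.2 hv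
  rw [h, dotProduct_smul, smul_eq_mul] at h1
  obtain ⟨h3, h4⟩ := Complex.pos_iff.1 h2
  have h1' : (μ * (star v ⬝ᵥ v)).im = 0 := h1
  rw [Complex.mul_im, ← h4] at h1'
  simp only [mul_zero, zero_add] at h1'
  exact (mul_eq_zero.1 h1').resolve_right h3.ne'

variable [DecidableEq ι]

theorem iSup_eigenspace_toLin'_eq_top {A : Matrix ι ι 𝕜} (hA : A.IsHermitian) :
    ⨆ μ : 𝕜, Module.End.eigenspace (toLin' A) μ = ⊤ := by
  rw [eq_top_iff]
  intro v _
  have h := hA.eigenvectorBasis.sum_repr (WithLp.toLp 2 v)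
  have h' : v = ∑ i, (hA.eigenvectorBasis.repr (WithLp.toLp 2 v)) i •
      (hA.eigenvectorBasis i).ofLp := by
    have := congrArg WithLp.ofLp h
    simpa using this.symm
  rw [h']
  refine Submodule.sum_mem _ fun i _ => Submodule.smul_mem _ _ ?_
  refine Submodule.mem_iSup_of_mem (hA.eigenvalues i : 𝕜) ?_
  rw [Module.End.mem_eigenspace_iff, toLin'_apply, hA.mulVec_eigenvectorBasis]
  exact (RCLike.real_smul_eq_coe_smul (K := 𝕜) _ _)

/-- An invariant subspace of a Hermitian matrix lies in any submodule which contains its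
eigenvectors. -/
theorem invariant_le_of_eigenvectors_mem {A : Matrix ι ι 𝕜} (hA : A.IsHermitian)
    {V U : Submodule 𝕜 (ι → 𝕜)} (hV : ∀ v ∈ V, A *ᵥ v ∈ V)
    (hU : ∀ v ∈ V, ∀ μ : 𝕜, A *ᵥ v = μ • v → v ∈ U) : V ≤ U := by
  -- A diagonalizable map stays diagonalizable on an invariant subspace: `V` is the sum of its
  -- intersections with the eigenspaces.
  have h := Submodule.eq_iSup_inf_genEigenspace (f := toLin' A) (p := V) 1
    (fun v hv => by simpa using hV v hv) (iSup_eigenspace_toLin'_eq_top hA)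
  rw [h]
  refine iSup_le fun μ v hv => hU v hv.1 μ ?_
  simpa using Module.End.mem_eigenspace_iff.1 hv.2

end Hermitian

section Dissipative

variable {ι : Type*} [Fintype ι]

theorem posSemidef_map_ofReal {L : Matrix ι ι ℝ} (hL : L.PosSemidef) :
    (L.map Complex.ofReal).PosSemidef := by
  classical
  obtain ⟨B, rfl⟩ := CStarAlgebra.nonneg_iff_eq_star_mul_self.1 hL.nonneg
  have : (star B * B).map Complex.ofReal = (B.map Complex.ofReal)ᴴ * B.map Complex.ofReal := by
    ext i j
    simp [mul_apply, star_eq_conjTranspose]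
  rw [this]
  exact posSemidef_conjTranspose_mul_self _

variable {A L : Matrix ι ι ℂ}

theorem star_dotProduct_of_eigenvector {v : ι → ℂ} {z : ℂ} (h : (L + Complex.I • A) *ᵥ v = z • v) :
    star v ⬝ᵥ (L *ᵥ v) + Complex.I * (star v ⬝ᵥ (A *ᵥ v)) = z * (star v ⬝ᵥ v) := by
  have := congrArg (star v ⬝ᵥ ·) h
  simpa [add_mulVec, smul_mulVec, dotProduct_add, dotProduct_smul] using this

theorem re_quadratic_of_eigenvector (hA : A.IsHermitian) {v : ι → ℂ} {z : ℂ}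
    (h : (L + Complex.I • A) *ᵥ v = z • v) :
    (star v ⬝ᵥ (L *ᵥ v)).re = z.re * (star v ⬝ᵥ v).re := by
  have h1 := congrArg Complex.re (star_dotProduct_of_eigenvector h)
  have h2 : (star v ⬝ᵥ (A *ᵥ v)).im = 0 := hA.im_star_dotProduct_mulVec_self v
  have h3 : (star v ⬝ᵥ v).im = 0 := ((Complex.nonneg_iff.1 (dotProduct_star_self_nonneg v)).2).symm
  simpa [h2, h3] using h1

theorem re_nonneg_of_eigenvector (hA : A.IsHermitian) (hL : L.PosSemidef) {v : ι → ℂ}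
    (hv : v ≠ 0) {z : ℂ} (h : (L + Complex.I • A) *ᵥ v = z • v) : 0 ≤ z.re := by
  have h1 := re_quadratic_of_eigenvector hA h
  have h2 : 0 < (star v ⬝ᵥ v).re := (Complex.pos_iff.1 (dotProduct_star_self_pos_iff.2 hv)).1
  have h3 : 0 ≤ (star v ⬝ᵥ (L *ᵥ v)).re :=
    (Complex.nonneg_iff.1 (hL.dotProduct_mulVec_nonneg v)).1
  rw [h1] at h3
  exact nonneg_of_mul_nonneg_left h3 h2

/-- An eigenvector for an eigenvalue on the imaginary axis is undamped. -/
theorem mulVec_eq_zero_of_imaginary_eigenvector (hA : A.IsHermitian) (hL : L.PosSemidef)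
    {v : ι → ℂ} {z : ℂ} (hz : z.re = 0) (h : (L + Complex.I • A) *ᵥ v = z • v) :
    L *ᵥ v = 0 ∧ A *ᵥ v = (-Complex.I * z) • v := by
  have h1 := re_quadratic_of_eigenvector hA h
  have h2 := Complex.nonneg_iff.1 (hL.dotProduct_mulVec_nonneg v)
  have hLv : L *ᵥ v = 0 := by
    rw [← hL.dotProduct_mulVec_zero_iff]
    apply Complex.ext
    · rw [h1, hz]; simp
    · exact h2.2.symm
  refine ⟨hLv, ?_⟩
  rw [add_mulVec, hLv, zero_add, smul_mulVec] at h
  rw [mul_smul, ← h, smul_smul]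
  simp

variable [DecidableEq ι]

/-- There are no Jordan chains: if `v = (Γ - z)u` is killed by `Γ - z`, then `L v = 0` and `A v =
-jz v`. As `L` and `A` are Hermitian and `z` is imaginary, `v` is orthogonal to the range of `Γ -
z`, which contains `v` itself. -/
theorem maxGenEigenspace_eq_eigenspace_of_imaginary (hA : A.IsHermitian) (hL : L.PosSemidef)
    {z : ℂ} (hz : z.re = 0) :
    Module.End.maxGenEigenspace (toLin' (L + Complex.I • A)) z =
      Module.End.eigenspace (toLin' (L + Complex.I • A)) z := by
  set f : Module.End ℂ (ι → ℂ) := toLin' (L + Complex.I • A) with hf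
  set g : Module.End ℂ (ι → ℂ) := f - algebraMap ℂ _ z with hg
  have hgapp : ∀ u, g u = (L + Complex.I • A) *ᵥ u - z • u := fun u => by
    simp only [hg, hf, LinearMap.sub_apply, toLin'_apply, Module.algebraMap_end_apply]
  have hsq : LinearMap.ker (g ^ 1) = LinearMap.ker (g ^ (1 : ℕ).succ) := by
    refine le_antisymm (LinearMap.ker_le_ker_comp _ _ |>.trans (by rw [pow_succ']; rfl)) ?_
    intro u hu
    rw [LinearMap.mem_ker, pow_two, Module.End.mul_apply] at hu
    rw [LinearMap.mem_ker, pow_one]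
    set v := g u with hv
    have h1 : (L + Complex.I • A) *ᵥ v = z • v := by
      rw [hgapp] at hu; exact sub_eq_zero.1 hu
    obtain ⟨hLv, hAv⟩ := mulVec_eq_zero_of_imaginary_eigenvector hA hL hz h1
    have key : star v ⬝ᵥ v = 0 := by
      have hL' : star v ⬝ᵥ (L *ᵥ u) = 0 := by
        rw [dotProduct_mulVec, ← hL.1.eq, ← star_mulVec, hLv]; simp
      have hA' : star v ⬝ᵥ (A *ᵥ u) = (Complex.I * star z) * (star v ⬝ᵥ u) := by
        rw [dotProduct_mulVec, ← hA.eq, ← star_mulVec, hAv, star_smul, smul_dotProduct]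
        simp
      have hzz : star z = -z := by
        apply Complex.ext <;> simp [hz]
      have hvu : star v ⬝ᵥ v = star v ⬝ᵥ ((L + Complex.I • A) *ᵥ u - z • u) := by
        rw [← hgapp]
      rw [hvu, dotProduct_sub, add_mulVec, smul_mulVec, dotProduct_add, dotProduct_smul,
        dotProduct_smul, hL', hA', hzz]
      simp only [smul_eq_mul]
      linear_combination (-z * (star v ⬝ᵥ u)) * Complex.I_mul_I
    exact dotProduct_star_self_eq_zero.1 key
  refine le_antisymm (fun u hu => ?_) (Module.End.genEigenspace_le_maximal f z 1)
  obtain ⟨k, hk⟩ := Module.End.mem_maxGenEigenspace f z u |>.1 hu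
  rw [Module.End.eigenspace_def]
  have h2 : u ∈ LinearMap.ker (g ^ (1 + k)) := by
    rw [LinearMap.mem_ker, pow_add, Module.End.mul_apply]
    have : (g ^ k) u = 0 := by simpa [hg, Algebra.algebraMap_eq_smul_one] using hk
    rw [this, map_zero]
  rw [← Module.End.ker_pow_constant hsq k, pow_one] at h2
  simpa [hg, Algebra.algebraMap_eq_smul_one] using h2

theorem finrank_biSup_of_iSupIndep {K V κ : Type*} [Field K] [AddCommGroup V] [Module K V]
    [FiniteDimensional K V] {f : κ → Submodule K V} (hf : iSupIndep f) (s : Finset κ) :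
    Module.finrank K (⨆ i ∈ s, f i : Submodule K V) = ∑ i ∈ s, Module.finrank K (f i) := by
  classical
  induction s using Finset.induction_on with
  | empty => simp
  | insert a s ha ih =>
    rw [Finset.iSup_insert, Finset.sum_insert ha, ← ih, ← Submodule.finrank_sup_add_finrank_inf_eq]
    have : Disjoint (f a) (⨆ i ∈ s, f i) :=
      (hf a).mono_right
        (iSup₂_le fun i hi => le_iSup₂_of_le i (ne_of_mem_of_not_mem hi ha) le_rfl)
    rw [this.eq_bot, finrank_bot, add_zero]

/-- The number of eigenvalues on the imaginary axis is the dimension of the span of the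
corresponding eigenvectors. -/
theorem imagAxisCount_eq_finrank (hA : A.IsHermitian) (hL : L.PosSemidef) :
    imagAxisCount (L + Complex.I • A) =
      Module.finrank ℂ (⨆ (z : ℂ) (_ : z.re = 0),
        Module.End.eigenspace (toLin' (L + Complex.I • A)) z : Submodule ℂ (ι → ℂ)) := by
  set f : Module.End ℂ (ι → ℂ) := toLin' (L + Complex.I • A) with hf
  -- Only finitely many eigenspaces are nonzero, so the supremum reduces to a finite direct sum.
  set s := (L + Complex.I • A).charpoly.roots.toFinset.filter (fun z => z.re = 0) with hs
  have h1 : (⨆ (z : ℂ) (_ : z.re = 0), f.eigenspace z) = ⨆ z ∈ s, f.eigenspace z := by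
    refine le_antisymm (iSup₂_le fun z hz => ?_) (iSup₂_le fun z hz => ?_)
    · by_cases hb : f.eigenspace z = ⊥
      · rw [hb]; exact bot_le
      · refine le_iSup₂_of_le z ?_ le_rfl
        have : f.HasEigenvalue z := hb
        rw [hs, Finset.mem_filter, Multiset.mem_toFinset,
          Polynomial.mem_roots (Matrix.charpoly_monic _).ne_zero, ← Matrix.charpoly_toLin']
        exact ⟨(Module.End.hasEigenvalue_iff_isRoot_charpoly _ _).1 this, hz⟩
    · exact le_iSup₂_of_le z (Finset.mem_filter.1 hz).2 le_rfl
  rw [h1, finrank_biSup_of_iSupIndep f.eigenspaces_iSupIndep, imagAxisCount,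
    Multiset.countP_eq_card_filter, ← Multiset.toFinset_sum_count_eq, Multiset.toFinset_filter]
  refine Finset.sum_congr rfl fun z hz => ?_
  have hz' := (Finset.mem_filter.1 hz).2
  rw [Multiset.count_filter_of_pos (p := fun z : ℂ => z.re = 0) hz', Polynomial.count_roots, ← Matrix.charpoly_toLin',
    ← LinearMap.finrank_maxGenEigenspace_eq, maxGenEigenspace_eq_eigenspace_of_imaginary hA hL hz']

end Dissipative

end SmallOscillations

/-! ### Synchronous vectors and the eigenvalue count -/

namespace SmallOscillations

section Synchronous

open scoped ComplexOrder

/-- The subspace `1 ⊗ 𝕜ⁿ` of vectors all of whose `q` blocks coincide. -/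
def syncSpace (𝕜 : Type*) [Field 𝕜] (q n : ℕ) : Submodule 𝕜 (Fin q × Fin n → 𝕜) where
  carrier := {v | ∀ i j a, v (i, a) = v (j, a)}
  add_mem' hu hv i j a := by simp [hu i j a, hv i j a]
  zero_mem' _ _ _ := rfl
  smul_mem' c v hv i j a := by simp [hv i j a]

theorem mem_syncSpace {𝕜 : Type*} [Field 𝕜] {q n : ℕ} {v : Fin q × Fin n → 𝕜} :
    v ∈ syncSpace 𝕜 q n ↔ ∀ i j a, v (i, a) = v (j, a) := Iff.rfl

theorem finrank_syncSpace (𝕜 : Type*) [Field 𝕜] {q : ℕ} (hq : 1 ≤ q) (n : ℕ) :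
    Module.finrank 𝕜 (syncSpace 𝕜 q n) = n := by
  let e : syncSpace 𝕜 q n ≃ₗ[𝕜] (Fin n → 𝕜) :=
    { toFun := fun v a => v.1 (⟨0, hq⟩, a)
      map_add' := fun _ _ => rfl
      map_smul' := fun _ _ => rfl
      invFun := fun u => ⟨fun p => u p.2, fun _ _ _ => rfl⟩
      left_inv := fun v => Subtype.ext (funext fun p => v.2 _ _ _)
      right_inv := fun _ => rfl }
  rw [e.finrank_eq, Module.finrank_fin_fun]

section RealPart

variable {ι : Type*}

theorem isHermitian_map_ofReal {A : Matrix ι ι ℝ} (hA : A.IsHermitian) :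
    (A.map Complex.ofReal).IsHermitian := by
  ext i j
  simp [← hA.apply i j]

variable [Fintype ι]

theorem re_map_ofReal_mulVec (A : Matrix ι ι ℝ) (v : ι → ℂ) :
    (fun i => ((A.map Complex.ofReal *ᵥ v) i).re) = A *ᵥ fun i => (v i).re := by
  ext i
  simp [mulVec, dotProduct]

theorem im_map_ofReal_mulVec (A : Matrix ι ι ℝ) (v : ι → ℂ) :
    (fun i => ((A.map Complex.ofReal *ᵥ v) i).im) = A *ᵥ fun i => (v i).im := by
  ext i
  simp [mulVec, dotProduct]

theorem map_ofReal_mulVec_ofReal (A : Matrix ι ι ℝ) (v : ι → ℝ) :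
    (A.map Complex.ofReal *ᵥ fun i => (v i : ℂ)) = fun i => ((A *ᵥ v) i : ℂ) := by
  ext i
  simp [mulVec, dotProduct]

theorem mulVec_re_im_eq_smul {A : Matrix ι ι ℝ} {v : ι → ℂ} {μ : ℝ}
    (h : A.map Complex.ofReal *ᵥ v = (μ : ℂ) • v) :
    (A *ᵥ fun i => (v i).re) = μ • (fun i => (v i).re) ∧
      (A *ᵥ fun i => (v i).im) = μ • fun i => (v i).im := by
  rw [← re_map_ofReal_mulVec, ← im_map_ofReal_mulVec, h]
  constructor <;> ext i <;> simp

end RealPart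

variable {q n : ℕ} {A L : Matrix (Fin q × Fin n) (Fin q × Fin n) ℝ}

theorem mem_syncSpace_complex {v : Fin q × Fin n → ℂ} :
    v ∈ syncSpace ℂ q n ↔
      (fun p => (v p).re) ∈ syncSpace ℝ q n ∧ (fun p => (v p).im) ∈ syncSpace ℝ q n := by
  simp only [mem_syncSpace, Complex.ext_iff]
  exact ⟨fun h => ⟨fun i j a => (h i j a).1, fun i j a => (h i j a).2⟩,
    fun h i j a => ⟨h.1 i j a, h.2 i j a⟩⟩

/-- The span of the eigenvectors of `L + j A` for eigenvalues on the imaginary axis. -/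
noncomputable def imaginaryModes {ι : Type*} [Fintype ι] [DecidableEq ι] (A L : Matrix ι ι ℝ) :
    Submodule ℂ (ι → ℂ) :=
  ⨆ (z : ℂ) (_ : z.re = 0), Module.End.eigenspace
    (toLin' (L.map Complex.ofReal + Complex.I • A.map Complex.ofReal)) z

theorem mem_imaginaryModes_of_mulVec {ι : Type*} [Fintype ι] [DecidableEq ι] {A L : Matrix ι ι ℝ}
    {v : ι → ℂ} {μ : ℝ} (hL : L.map Complex.ofReal *ᵥ v = 0)
    (hA : A.map Complex.ofReal *ᵥ v = (μ : ℂ) • v) : v ∈ imaginaryModes A L := by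
  refine Submodule.mem_iSup_of_mem (Complex.I * μ) (Submodule.mem_iSup_of_mem (by simp) ?_)
  rw [Module.End.mem_eigenspace_iff, toLin'_apply, add_mulVec, hL, smul_mulVec, hA, smul_smul,
    zero_add]

/-- The synchronous space is invariant under the Hermitian `A`, hence spanned by eigenvectors of
`A`. Each has a real eigenvalue `μ` and is killed by `L`, so it belongs to the eigenvalue `jμ` of `L
+ jA`. -/
theorem syncSpace_le_imaginaryModes (hA : A.IsHermitian)
    (hAs : ∀ v ∈ syncSpace ℝ q n, A *ᵥ v ∈ syncSpace ℝ q n)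
    (hLs : ∀ v ∈ syncSpace ℝ q n, L *ᵥ v = 0) :
    syncSpace ℂ q n ≤ imaginaryModes A L := by
  refine invariant_le_of_eigenvectors_mem (isHermitian_map_ofReal hA) (fun v hv => ?_)
    fun v hv μ h => ?_
  · obtain ⟨h1, h2⟩ := mem_syncSpace_complex.1 hv
    rw [mem_syncSpace_complex, re_map_ofReal_mulVec, im_map_ofReal_mulVec]
    exact ⟨hAs _ h1, hAs _ h2⟩
  · by_cases hv0 : v = 0
    · rw [hv0]; exact Submodule.zero_mem _
    have hμ := im_eq_zero_of_mulVec_eq_smul (isHermitian_map_ofReal hA) hv0 h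
    obtain ⟨h1, h2⟩ := mem_syncSpace_complex.1 hv
    refine mem_imaginaryModes_of_mulVec (μ := μ.re) ?_ ?_
    · have h3 := (re_map_ofReal_mulVec L v).trans (hLs _ h1)
      have h4 := (im_map_ofReal_mulVec L v).trans (hLs _ h2)
      ext i
      exact Complex.ext (congrFun h3 i) (congrFun h4 i)
    · rw [h]
      congr 1
      exact Complex.ext (by simp) (by simpa using hμ)

theorem le_imagAxisCount (hq : 1 ≤ q) (hA : A.IsHermitian) (hL : L.PosSemidef)
    (hAs : ∀ v ∈ syncSpace ℝ q n, A *ᵥ v ∈ syncSpace ℝ q n)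
    (hLs : ∀ v ∈ syncSpace ℝ q n, L *ᵥ v = 0) :
    n ≤ imagAxisCount (L.map Complex.ofReal + Complex.I • A.map Complex.ofReal) := by
  rw [imagAxisCount_eq_finrank (isHermitian_map_ofReal hA) (posSemidef_map_ofReal hL)]
  conv_lhs => rw [← finrank_syncSpace ℂ hq n]
  exact Submodule.finrank_mono (syncSpace_le_imaginaryModes hA hAs hLs)

/-- There are exactly `n` eigenvalues on the imaginary axis iff all undamped modes are
synchronous. -/
theorem imagAxisCount_eq_iff (hq : 1 ≤ q) (hA : A.IsHermitian) (hL : L.PosSemidef)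
    (hAs : ∀ v ∈ syncSpace ℝ q n, A *ᵥ v ∈ syncSpace ℝ q n)
    (hLs : ∀ v ∈ syncSpace ℝ q n, L *ᵥ v = 0) :
    imagAxisCount (L.map Complex.ofReal + Complex.I • A.map Complex.ofReal) = n ↔
      ∀ (v : Fin q × Fin n → ℝ) (μ : ℝ), L *ᵥ v = 0 → A *ᵥ v = μ • v → v ∈ syncSpace ℝ q n := by
  have hA' := isHermitian_map_ofReal hA
  have hL' := posSemidef_map_ofReal hL
  have hle := syncSpace_le_imaginaryModes hA hAs hLs
  rw [imagAxisCount_eq_finrank hA' hL']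
  change Module.finrank ℂ (imaginaryModes A L) = n ↔ _
  constructor
  · intro h v μ hLv hAv
    have heq : syncSpace ℂ q n = imaginaryModes A L :=
      Submodule.eq_of_le_of_finrank_eq hle (by rw [h, finrank_syncSpace ℂ hq n])
    have hv : (fun p => (v p : ℂ)) ∈ syncSpace ℂ q n := by
      rw [heq]
      refine mem_imaginaryModes_of_mulVec (μ := μ) ?_ ?_
      · rw [map_ofReal_mulVec_ofReal, hLv]
        ext i
        simp
      · rw [map_ofReal_mulVec_ofReal, hAv]
        ext i
        simp
    simpa using (mem_syncSpace_complex.1 hv).1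
  · intro h
    have heq : imaginaryModes A L = syncSpace ℂ q n := by
      refine le_antisymm (iSup₂_le fun z hz v hv => ?_) hle
      rw [Module.End.mem_eigenspace_iff, toLin'_apply] at hv
      obtain ⟨h1, h2⟩ := mulVec_eq_zero_of_imaginary_eigenvector hA' hL' hz hv
      -- The eigenvalue of `A` is real, so the real and imaginary parts of `v` are separately
      -- undamped modes.
      have hzz : -Complex.I * z = (z.im : ℂ) := by
        apply Complex.ext <;> simp [hz]
      rw [hzz] at h2
      have h3 : L.map Complex.ofReal *ᵥ v = ((0 : ℝ) : ℂ) • v := by simpa using h1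
      obtain ⟨h4, h5⟩ := mulVec_re_im_eq_smul h3
      obtain ⟨h6, h7⟩ := mulVec_re_im_eq_smul h2
      rw [zero_smul] at h4 h5
      exact mem_syncSpace_complex.2 ⟨h _ _ h4 h6, h _ _ h5 h7⟩
    rw [heq, finrank_syncSpace ℂ hq n]

end Synchronous

/-! ### Counting through the sorted list of real parts -/

section Ordering

variable {ι : Type*} [Fintype ι] [DecidableEq ι]

theorem imagAxisCount_eq_card {X : Matrix ι ι ℂ} {lam : Fin (Fintype.card ι) → ℂ}
    (h : IsEigenvalueOrdering X lam) :
    imagAxisCount X = (Finset.univ.filter fun k => (lam k).re = 0).card := by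
  rw [imagAxisCount, ← h.1, Multiset.countP_map]
  rfl

/-- If the eigenvalues lie in the closed right half-plane and at least `n` of them are on the
imaginary axis, then exactly `n` of them are iff the `(n + 1)`-st one has positive real part. -/
theorem imagAxisCount_eq_iff_re_pos {X : Matrix ι ι ℂ} {lam : Fin (Fintype.card ι) → ℂ}
    (h : IsEigenvalueOrdering X lam) (hre : ∀ z ∈ X.charpoly.roots, 0 ≤ z.re) {n : ℕ}
    (hn : n < Fintype.card ι) (hcount : n ≤ imagAxisCount X) :
    imagAxisCount X = n ↔ 0 < (lam ⟨n, hn⟩).re := by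
  have hnn : ∀ k, 0 ≤ (lam k).re := fun k => hre _ (by
    rw [← h.1]
    exact Multiset.mem_map_of_mem _ (Finset.mem_univ k))
  rw [imagAxisCount_eq_card h] at hcount ⊢
  constructor
  · intro hc
    by_contra hpos
    have h0 : (lam ⟨n, hn⟩).re = 0 := le_antisymm (not_lt.1 hpos) (hnn _)
    -- Indices start at 0: `Iic n` has `n + 1` elements, one too many, whereas `Iio n` below has
    -- `n`.
    have hsub : Finset.Iic (⟨n, hn⟩ : Fin _) ⊆
        Finset.univ.filter fun k => (lam k).re = 0 := fun k hk => by
      rw [Finset.mem_filter]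
      refine ⟨Finset.mem_univ _, le_antisymm ?_ (hnn _)⟩
      rw [← h0]
      exact h.2 (Finset.mem_Iic.1 hk)
    have := Finset.card_le_card hsub
    rw [Fin.card_Iic, hc] at this
    simp at this
  · intro hpos
    refine le_antisymm ?_ hcount
    have hsub : (Finset.univ.filter fun k => (lam k).re = 0) ⊆
        Finset.Iio (⟨n, hn⟩ : Fin _) := fun k hk => by
      rw [Finset.mem_Iio]
      by_contra hk'
      have h1 : (lam ⟨n, hn⟩).re ≤ (lam k).re := h.2 (not_lt.1 hk')
      rw [(Finset.mem_filter.1 hk).2] at h1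
      exact absurd hpos (not_lt.2 h1)
    have := Finset.card_le_card hsub
    rwa [Fin.card_Iio] at this

end Ordering

end SmallOscillations

namespace SmallOscillations

/-! ### Matrix-weighted Laplacians -/

section Laplacian

variable {n q : ℕ} {W : Fin q → Fin q → Matrix (Fin n) (Fin n) ℝ}

theorem lap_mulVec (hW : ∀ i, W i i = 0) (z : Fin q × Fin n → ℝ) (i : Fin q) :
    (fun a => (lap W *ᵥ z) (i, a)) =
      ∑ j, W i j *ᵥ ((fun a => z (i, a)) - fun a => z (j, a)) := by
  -- Since `W i i = 0`, one formula covers both diagonal and off-diagonal blocks.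
  have hblock : ∀ a k, ∑ b, lap W (i, a) (k, b) * z (k, b) =
      (if i = k then ((∑ j, W i j) *ᵥ fun b => z (i, b)) a else 0) -
        (W i k *ᵥ fun b => z (k, b)) a := by
    intro a k
    by_cases hk : i = k
    · subst hk
      simp [lap, hW, mulVec, dotProduct]
    · simp [lap, hk, mulVec, dotProduct]
  ext a
  rw [mulVec, dotProduct, Fintype.sum_prod_type]
  simp only [hblock, Finset.sum_sub_distrib, Finset.sum_ite_eq, Finset.mem_univ, if_true,
    mulVec_sub, sum_mulVec, Finset.sum_apply, Pi.sub_apply]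

theorem lap_mulVec_of_mem_syncSpace (hW : ∀ i, W i i = 0) {z : Fin q × Fin n → ℝ}
    (hz : z ∈ syncSpace ℝ q n) : lap W *ᵥ z = 0 := by
  ext ⟨i, a⟩
  have h : ∀ j, ((fun a => z (i, a)) - fun a => z (j, a)) = 0 := fun j => by
    ext b
    simp [hz i j b]
  have := congrFun (lap_mulVec hW z i) a
  simpa [h] using this

/-- Swapping `i` and `j` and averaging gives `z·lap(W)z = ½ ∑ (y_i - y_j)·W_ij(y_i - y_j)`, where
`y_i` is the `i`-th block of `z`. -/
theorem posSemidef_lap (hpsd : ∀ i j, (W i j).PosSemidef) (hsymm : ∀ i j, W i j = W j i)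
    (hW : ∀ i, W i i = 0) : (lap W).PosSemidef := by
  have hent : ∀ i j a b, W i j a b = W i j b a := fun i j a b => by
    simpa using (hpsd i j).1.apply b a
  refine PosSemidef.of_dotProduct_mulVec_nonneg ?_ fun z => ?_
  · ext ⟨i, a⟩ ⟨k, b⟩
    by_cases hk : i = k
    · subst hk
      simp only [lap, conjTranspose_apply, of_apply, if_true, Matrix.sum_apply, star_trivial]
      exact Finset.sum_congr rfl fun j _ => hent _ _ _ _
    · simp only [lap, conjTranspose_apply, of_apply, if_neg hk, if_neg (Ne.symm hk), star_trivial]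
      rw [hsymm k i, hent]
  · set y : Fin q → Fin n → ℝ := fun i a => z (i, a) with hy
    have h1 : star z ⬝ᵥ (lap W *ᵥ z) = ∑ i, ∑ j, y i ⬝ᵥ (W i j *ᵥ (y i - y j)) := by
      rw [star_trivial, dotProduct, Fintype.sum_prod_type]
      refine Finset.sum_congr rfl fun i _ => ?_
      rw [← dotProduct_sum]
      rw [← lap_mulVec hW z i]
      rfl
    have h2 : ∑ i, ∑ j, y i ⬝ᵥ (W i j *ᵥ (y i - y j)) =
        -∑ i, ∑ j, y j ⬝ᵥ (W i j *ᵥ (y i - y j)) := by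
      rw [Finset.sum_comm, ← Finset.sum_neg_distrib]
      refine Finset.sum_congr rfl fun i _ => ?_
      rw [← Finset.sum_neg_distrib]
      refine Finset.sum_congr rfl fun j _ => ?_
      rw [hsymm j i, ← dotProduct_neg, ← mulVec_neg, neg_sub]
    have h3 : 0 ≤ ∑ i, ∑ j, (y i - y j) ⬝ᵥ (W i j *ᵥ (y i - y j)) :=
      Finset.sum_nonneg fun i _ => Finset.sum_nonneg fun j _ => by
        simpa using (hpsd i j).dotProduct_mulVec_nonneg (y i - y j)
    simp only [sub_dotProduct, Finset.sum_sub_distrib] at h3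
    rw [h1]
    linarith

theorem one_kronecker_mulVec (P : Matrix (Fin n) (Fin n) ℝ) (z : Fin q × Fin n → ℝ) (i : Fin q) :
    (fun a => (((1 : Matrix (Fin q) (Fin q) ℝ) ⊗ₖ P) *ᵥ z) (i, a)) =
      P *ᵥ fun a => z (i, a) := by
  ext a
  rw [mulVec, dotProduct, Fintype.sum_prod_type]
  simp [one_apply, mulVec, dotProduct, ite_mul]

end Laplacian

/-! ### The change of coordinates by `M^{1/2}` -/

section SquareRoot

variable {n : ℕ} {M : Matrix (Fin n) (Fin n) ℝ}

theorem posDef_sqrt (hM : M.PosDef) : (CFC.sqrt M).PosDef :=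
  hM.isStrictlyPositive.sqrt.posDef

theorem sqrt_mul_invSqrt (hM : M.PosDef) : CFC.sqrt M * invSqrt M = 1 :=
  Matrix.mul_nonsing_inv _ ((Matrix.isUnit_iff_isUnit_det _).1 (posDef_sqrt hM).isUnit)

theorem invSqrt_mul_sqrt (hM : M.PosDef) : invSqrt M * CFC.sqrt M = 1 :=
  Matrix.nonsing_inv_mul _ ((Matrix.isUnit_iff_isUnit_det _).1 (posDef_sqrt hM).isUnit)

theorem sqrt_mul_sqrt (hM : M.PosDef) : CFC.sqrt M * CFC.sqrt M = M :=
  CFC.sqrt_mul_sqrt_self M hM.posSemidef.nonneg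

theorem posDef_invSqrt (hM : M.PosDef) : (invSqrt M).PosDef := (posDef_sqrt hM).inv

theorem posSemidef_invSqrt_mul_mul (hM : M.PosDef) {B : Matrix (Fin n) (Fin n) ℝ}
    (hB : B.PosSemidef) : (invSqrt M * B * invSqrt M).PosSemidef := by
  have := hB.mul_mul_conjTranspose_same (invSqrt M)
  rwa [(posDef_invSqrt hM).1.eq] at this

theorem posDef_matP (hM : M.PosDef) {K : Matrix (Fin n) (Fin n) ℝ} (hK : K.PosDef) :
    (matP M K).PosDef := by
  have h := posSemidef_invSqrt_mul_mul hM hK.posSemidef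
  exact h.posDef_iff_isUnit.2
    (((posDef_invSqrt hM).isUnit.mul hK.isUnit).mul (posDef_invSqrt hM).isUnit)

theorem invSqrt_mul_mul_mulVec_sqrt (hM : M.PosDef) (B : Matrix (Fin n) (Fin n) ℝ)
    (u : Fin n → ℝ) :
    (invSqrt M * B * invSqrt M) *ᵥ (CFC.sqrt M *ᵥ u) = invSqrt M *ᵥ (B *ᵥ u) := by
  rw [mulVec_mulVec, mul_assoc _ (invSqrt M), invSqrt_mul_sqrt hM, mul_one, mulVec_mulVec]

theorem sqrt_mulVec_invSqrt_mul_mul (hM : M.PosDef) (B : Matrix (Fin n) (Fin n) ℝ)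
    (u : Fin n → ℝ) :
    CFC.sqrt M *ᵥ ((invSqrt M * B * invSqrt M) *ᵥ u) = B *ᵥ (invSqrt M *ᵥ u) := by
  rw [mulVec_mulVec, mul_assoc (invSqrt M), ← mul_assoc, sqrt_mul_invSqrt hM, one_mul,
    mulVec_mulVec]

theorem invSqrt_mulVec_mulVec (hM : M.PosDef) (u : Fin n → ℝ) :
    invSqrt M *ᵥ (M *ᵥ u) = CFC.sqrt M *ᵥ u := by
  have h : invSqrt M * M = CFC.sqrt M := by
    calc invSqrt M * M = invSqrt M * (CFC.sqrt M * CFC.sqrt M) := by rw [sqrt_mul_sqrt hM]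
      _ = CFC.sqrt M := by rw [← mul_assoc, invSqrt_mul_sqrt hM, one_mul]
  rw [mulVec_mulVec, h]

theorem mulVec_invSqrt_mulVec (hM : M.PosDef) (u : Fin n → ℝ) :
    M *ᵥ (invSqrt M *ᵥ u) = CFC.sqrt M *ᵥ u := by
  have h : M * invSqrt M = CFC.sqrt M := by
    calc M * invSqrt M = CFC.sqrt M * CFC.sqrt M * invSqrt M := by rw [sqrt_mul_sqrt hM]
      _ = CFC.sqrt M := by rw [mul_assoc, sqrt_mul_invSqrt hM, mul_one]
  rw [mulVec_mulVec, h]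

end SquareRoot

/-! ### Synchronization and undamped modes -/

section Array

variable {n q : ℕ} {M K : Matrix (Fin n) (Fin n) ℝ}
  {D R W : Fin q → Fin q → Matrix (Fin n) (Fin n) ℝ}

/-- The stiffness `I ⊗ P + L_r` of the array in the coordinates `zᵢ = M ^ (1/2) xᵢ`. -/
noncomputable def arrayStiffness (M K : Matrix (Fin n) (Fin n) ℝ)
    (R : Fin q → Fin q → Matrix (Fin n) (Fin n) ℝ) :
    Matrix (Fin q × Fin n) (Fin q × Fin n) ℝ :=
  (1 : Matrix (Fin q) (Fin q) ℝ) ⊗ₖ matP M K + couplingLap M R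

theorem posSemidef_couplingLap (hM : M.PosDef) (hpsd : ∀ i j, (W i j).PosSemidef)
    (hsymm : ∀ i j, W i j = W j i) (hW : ∀ i, W i i = 0) : (couplingLap M W).PosSemidef :=
  posSemidef_lap (fun i j => posSemidef_invSqrt_mul_mul hM (hpsd i j))
    (fun i j => by rw [hsymm i j]) (fun i => by simp [hW])

theorem couplingLap_mulVec (hW : ∀ i, W i i = 0) (z : Fin q × Fin n → ℝ) (i : Fin q) :
    (fun a => (couplingLap M W *ᵥ z) (i, a)) = ∑ j, (invSqrt M * W i j * invSqrt M) *ᵥ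
      ((fun a => z (i, a)) - fun a => z (j, a)) :=
  lap_mulVec (fun i => by simp [hW]) z i

theorem posDef_arrayStiffness (hM : M.PosDef) (hK : K.PosDef) (hR : ∀ i j, (R i j).PosSemidef)
    (hRsymm : ∀ i j, R i j = R j i) (hRdiag : ∀ i, R i i = 0) :
    (arrayStiffness M K R).PosDef :=
  (PosDef.one.kronecker (posDef_matP hM hK)).add_posSemidef
    (posSemidef_couplingLap hM hR hRsymm hRdiag)

theorem arrayStiffness_mulVec (hRdiag : ∀ i, R i i = 0) (z : Fin q × Fin n → ℝ) (i : Fin q) :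
    (fun a => (arrayStiffness M K R *ᵥ z) (i, a)) = matP M K *ᵥ (fun a => z (i, a)) +
      ∑ j, (invSqrt M * R i j * invSqrt M) *ᵥ ((fun a => z (i, a)) - fun a => z (j, a)) := by
  rw [← one_kronecker_mulVec, ← couplingLap_mulVec hRdiag, arrayStiffness]
  ext a
  simp [add_mulVec]

theorem couplingLap_mulVec_of_mem_syncSpace (hW : ∀ i, W i i = 0) {z : Fin q × Fin n → ℝ}
    (hz : z ∈ syncSpace ℝ q n) : couplingLap M W *ᵥ z = 0 :=
  lap_mulVec_of_mem_syncSpace (fun i => by simp [hW]) hz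

theorem arrayStiffness_mulVec_mem_syncSpace (hRdiag : ∀ i, R i i = 0) {z : Fin q × Fin n → ℝ}
    (hz : z ∈ syncSpace ℝ q n) : arrayStiffness M K R *ᵥ z ∈ syncSpace ℝ q n := by
  rw [arrayStiffness, add_mulVec, couplingLap_mulVec_of_mem_syncSpace hRdiag hz, add_zero]
  intro i j a
  have hij : (fun b => z (i, b)) = fun b => z (j, b) := funext fun b => hz i j b
  have h1 := congrFun (one_kronecker_mulVec (matP M K) z i) a
  have h2 := congrFun (one_kronecker_mulVec (matP M K) z j) a
  rw [hij] at h1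
  exact h1.trans h2.symm

/-- If all undamped modes are synchronous, then the array synchronizes. -/
theorem synchronizes_of_undamped_modes (hM : M.PosDef) (hK : K.PosDef)
    (hD : ∀ i j, (D i j).PosSemidef) (hDsymm : ∀ i j, D i j = D j i) (hDdiag : ∀ i, D i i = 0)
    (hR : ∀ i j, (R i j).PosSemidef) (hRsymm : ∀ i j, R i j = R j i) (hRdiag : ∀ i, R i i = 0)
    (h : ∀ (v : Fin q × Fin n → ℝ) (μ : ℝ), couplingLap M D *ᵥ v = 0 →
      arrayStiffness M K R *ᵥ v = μ • v → v ∈ syncSpace ℝ q n) :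
    Synchronizes M K D R := by
  rintro x ⟨hx1, hx2, hx⟩ i j
  set S := CFC.sqrt M with hS
  have hA := posDef_arrayStiffness hM hK hR hRsymm hRdiag
  have hz : ∀ t, HasDerivAt (fun t (p : Fin q × Fin n) => (S *ᵥ x p.1 t) p.2)
      (fun p => (S *ᵥ deriv (x p.1) t) p.2) t := fun t =>
    hasDerivAt_pi.2 fun p =>
      hasDerivAt_pi.1 (hasDerivAt_mulVec S (hx1 p.1 t).hasDerivAt) p.2
  have hv : ∀ t, HasDerivAt (fun t (p : Fin q × Fin n) => (S *ᵥ deriv (x p.1) t) p.2)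
      (-(arrayStiffness M K R *ᵥ fun p => (S *ᵥ x p.1 t) p.2) -
        couplingLap M D *ᵥ fun p => (S *ᵥ deriv (x p.1) t) p.2) t := fun t =>
    hasDerivAt_pi.2 fun ⟨k, a⟩ => by
      refine (hasDerivAt_pi.1 (hasDerivAt_mulVec S (hx2 k t).hasDerivAt) a).congr_deriv ?_
      have h1 := congrFun (arrayStiffness_mulVec (M := M) (K := K) hRdiag
        (fun p => (S *ᵥ x p.1 t) p.2) k) a
      have h2 := congrFun (couplingLap_mulVec (M := M) hDdiag
        (fun p => (S *ᵥ deriv (x p.1) t) p.2) k) a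
      -- The `k`-th equation of motion, multiplied by `M^{-1/2}`.
      have h3 := congrFun (congrArg (invSqrt M *ᵥ ·) (hx k t)) a
      simp only [mulVec_add, mulVec_sum, mulVec_zero, invSqrt_mulVec_mulVec hM] at h3
      simp only [matP, ← mulVec_sub, hS, invSqrt_mul_mul_mulVec_sqrt hM] at h1 h2
      simp only [Pi.add_apply, Pi.sub_apply, Pi.neg_apply, Pi.zero_apply] at h1 h2 h3 ⊢
      rw [h1, h2, hS]
      linarith
  -- The norm of `x_i - x_j` in terms of `z`; it vanishes on the synchronous space.
  let G : (Fin q × Fin n → ℝ) → ℝ := fun z =>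
    ‖WithLp.toLp 2 (invSqrt M *ᵥ ((fun a => z (i, a)) - fun a => z (j, a)))‖
  have hG : Continuous G := by
    refine continuous_norm.comp ((PiLp.continuous_toLp 2 _).comp ?_)
    fun_prop
  have key := tendsto_zero_of_damped_oscillator hA (posSemidef_couplingLap hM hD hDsymm hDdiag)
    (U := syncSpace ℝ q n)
    (fun V hV hVL => invariant_le_of_eigenvectors_mem hA.1 hV fun v hv μ hμ => h v μ (hVL v hv) hμ)
    hz hv hG fun u hu => by
      have : ((fun a => u (i, a)) - fun a => u (j, a)) = 0 := by
        ext a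
        simp [hu i j a]
      simp [G, this]
  refine key.congr fun t => ?_
  simp only [G]
  congr 2
  change invSqrt M *ᵥ (S *ᵥ x i t - S *ᵥ x j t) = _
  rw [← mulVec_sub, mulVec_mulVec, invSqrt_mul_sqrt hM, one_mulVec]

/-- An undamped mode gives rise to a harmonic solution. -/
theorem isSolution_cos_of_undamped_mode (hM : M.PosDef) (hDdiag : ∀ i, D i i = 0)
    (hRdiag : ∀ i, R i i = 0) {v : Fin q × Fin n → ℝ} {ω : ℝ}
    (hDv : couplingLap M D *ᵥ v = 0) (hAv : arrayStiffness M K R *ᵥ v = ω ^ 2 • v) :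
    IsSolution M K D R fun i t => Real.cos (ω * t) • (invSqrt M *ᵥ fun a => v (i, a)) := by
  have hlin : ∀ t, HasDerivAt (fun t : ℝ => ω * t) ω t := fun t => by
    simpa using (hasDerivAt_id t).const_mul ω
  have h1 : ∀ (u : Fin n → ℝ) t,
      HasDerivAt (fun t : ℝ => Real.cos (ω * t) • u) ((-Real.sin (ω * t) * ω) • u) t :=
    fun u t => ((hlin t).cos).smul_const u
  have h2 : ∀ (u : Fin n → ℝ) t,
      HasDerivAt (fun t : ℝ => (-Real.sin (ω * t) * ω) • u)
        ((-(Real.cos (ω * t) * ω) * ω) • u) t :=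
    fun u t => (((hlin t).sin.neg).mul_const ω).smul_const u
  have hd : ∀ u : Fin n → ℝ, deriv (fun t : ℝ => Real.cos (ω * t) • u) =
      fun t => (-Real.sin (ω * t) * ω) • u := fun u => funext fun t => (h1 u t).deriv
  refine ⟨fun i t => (h1 _ t).differentiableAt, fun i t => ?_, fun i t => ?_⟩
  · simp only [hd]
    exact (h2 _ t).differentiableAt
  · simp only [hd, (h2 _ _).deriv]
    have h3 : ∑ j, D i j *ᵥ (invSqrt M *ᵥ ((fun a => v (i, a)) - fun a => v (j, a))) = 0 := by
      have := congrArg (CFC.sqrt M *ᵥ ·) (couplingLap_mulVec (M := M) hDdiag v i)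
      simp only [mulVec_sum, sqrt_mulVec_invSqrt_mul_mul hM, hDv] at this
      rw [← this]
      exact mulVec_zero _
    have h4 : K *ᵥ (invSqrt M *ᵥ fun a => v (i, a)) +
        ∑ j, R i j *ᵥ (invSqrt M *ᵥ ((fun a => v (i, a)) - fun a => v (j, a))) =
        ω ^ 2 • (CFC.sqrt M *ᵥ fun a => v (i, a)) := by
      have := congrArg (CFC.sqrt M *ᵥ ·) (arrayStiffness_mulVec (M := M) (K := K) hRdiag v i)
      simp only [matP, mulVec_add, mulVec_sum, sqrt_mulVec_invSqrt_mul_mul hM, hAv] at this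
      rw [← this, ← mulVec_smul]
      rfl
    simp only [← smul_sub, ← mulVec_sub, mulVec_smul, ← Finset.smul_sum, h3, smul_zero, add_zero,
      mulVec_invSqrt_mulVec hM]
    rw [add_assoc, ← smul_add, h4, smul_smul, ← add_smul]
    -- The inertial coefficient `-ω² cos(ωt)` cancels the stiffness coefficient `ω² cos(ωt)`.
    convert zero_smul ℝ _ using 2
    ring

/-- If the array synchronizes, then all undamped modes are synchronous. -/
theorem mem_syncSpace_of_synchronizes (hM : M.PosDef) (hK : K.PosDef) (hDdiag : ∀ i, D i i = 0)
    (hR : ∀ i j, (R i j).PosSemidef) (hRsymm : ∀ i j, R i j = R j i) (hRdiag : ∀ i, R i i = 0)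
    (hsync : Synchronizes M K D R) {v : Fin q × Fin n → ℝ} {μ : ℝ}
    (hDv : couplingLap M D *ᵥ v = 0) (hAv : arrayStiffness M K R *ᵥ v = μ • v) :
    v ∈ syncSpace ℝ q n := by
  by_cases hv0 : v = 0
  · rw [hv0]; exact Submodule.zero_mem _
  have hμ : 0 < μ := by
    have h1 := (posDef_arrayStiffness hM hK hR hRsymm hRdiag).dotProduct_mulVec_pos hv0
    have h2 : 0 < star v ⬝ᵥ v := dotProduct_star_self_pos_iff.2 hv0
    rw [hAv, dotProduct_smul, smul_eq_mul] at h1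
    exact pos_of_mul_pos_left h1 h2.le
  have hω : 0 < √μ := Real.sqrt_pos.2 hμ
  intro i j a
  have hlim := hsync _ (isSolution_cos_of_undamped_mode hM hDdiag hRdiag (ω := √μ) hDv
    (by rw [hAv, Real.sq_sqrt hμ.le])) i j
  -- At the times `2πk/√μ` the cosine is 1, so the norm of the difference is constant along this
  -- sequence; tending to 0, it must vanish.
  have hseq : Tendsto (fun k : ℕ => (k : ℝ) * (2 * Real.pi) / √μ) atTop atTop :=
    (tendsto_natCast_atTop_atTop.atTop_mul_const Real.two_pi_pos).atTop_div_const hω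
  have h1 := hlim.comp hseq
  have h2 : ∀ k : ℕ, Real.cos (√μ * ((k : ℝ) * (2 * Real.pi) / √μ)) = 1 := fun k => by
    rw [mul_div_cancel₀ _ hω.ne', Real.cos_nat_mul_two_pi]
  simp only [Function.comp_def, h2, one_smul] at h1
  have h3 := (tendsto_nhds_unique h1 tendsto_const_nhds).symm
  rw [norm_eq_zero, WithLp.toLp_eq_zero, sub_eq_zero] at h3
  exact congrFun (Matrix.mulVec_injective_of_isUnit (posDef_invSqrt hM).isUnit h3) a

/-- The array synchronizes iff exactly `n` eigenvalues of `Γ` lie on the imaginary axis. -/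
theorem synchronizes_iff_imagAxisCount_eq {n q : ℕ} (hq : 1 ≤ q)
    {M K : Matrix (Fin n) (Fin n) ℝ} (hM : M.PosDef) (hK : K.PosDef)
    {D R : Fin q → Fin q → Matrix (Fin n) (Fin n) ℝ}
    (hD : ∀ i j, (D i j).PosSemidef) (hDsymm : ∀ i j, D i j = D j i) (hDdiag : ∀ i, D i i = 0)
    (hR : ∀ i j, (R i j).PosSemidef) (hRsymm : ∀ i j, R i j = R j i) (hRdiag : ∀ i, R i i = 0) :
    Synchronizes M K D R ↔ imagAxisCount (matGamma M K D R) = n :=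
  Iff.trans
    ⟨fun h _ _ => mem_syncSpace_of_synchronizes hM hK hDdiag hR hRsymm hRdiag h,
      synchronizes_of_undamped_modes hM hK hD hDsymm hDdiag hR hRsymm hRdiag⟩
    (imagAxisCount_eq_iff hq (posDef_arrayStiffness hM hK hR hRsymm hRdiag).1
      (posSemidef_couplingLap hM hD hDsymm hDdiag)
      (fun _ => arrayStiffness_mulVec_mem_syncSpace hRdiag)
      (fun _ => couplingLap_mulVec_of_mem_syncSpace hDdiag)).symm

end Array

end SmallOscillations

theorem mainTheorem1 (n q : ℕ) (hn : 1 ≤ n) (hq : 1 ≤ q)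
    (M K : Matrix (Fin n) (Fin n) ℝ) (hM : M.PosDef) (hK : K.PosDef)
    (D R : Fin q → Fin q → Matrix (Fin n) (Fin n) ℝ)
    (hD : ∀ i j, (D i j).PosSemidef) (hDsymm : ∀ i j, D i j = D j i) (hDdiag : ∀ i, D i i = 0)
    (hR : ∀ i j, (R i j).PosSemidef) (hRsymm : ∀ i j, R i j = R j i) (hRdiag : ∀ i, R i i = 0)
    (hdistinct : (SmallOscillations.matP M K).charpoly.roots.Nodup) :
    (∀ (hq2 : 2 ≤ q) (lam : Fin (Fintype.card (Fin q × Fin n)) → ℂ),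
      SmallOscillations.IsEigenvalueOrdering (SmallOscillations.matGamma M K D R) lam →
      (SmallOscillations.Synchronizes M K D R ↔
        0 < (lam ⟨n, SmallOscillations.lt_card_prod hn hq2⟩).re)) ∧
    (SmallOscillations.Synchronizes M K D R ↔
      SmallOscillations.imagAxisCount (SmallOscillations.matGamma M K D R) = n) := by
  have hA := (SmallOscillations.posDef_arrayStiffness hM hK hR hRsymm hRdiag).1
  have hL := SmallOscillations.posSemidef_couplingLap hM hD hDsymm hDdiag
  have hiff := SmallOscillations.synchronizes_iff_imagAxisCount_eq hq hM hK hD hDsymm hDdiag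
    hR hRsymm hRdiag
  refine ⟨fun hq2 lam hlam => hiff.trans
    (SmallOscillations.imagAxisCount_eq_iff_re_pos hlam (fun z hz => ?_) _ ?_), hiff⟩
  -- The two remaining goals: the spectrum lies in the closed right half-plane, and the synchronous
  -- modes give at least `n` imaginary eigenvalues.
  · rw [Polynomial.mem_roots (Matrix.charpoly_monic _).ne_zero, ← Matrix.charpoly_toLin',
      ← Module.End.hasEigenvalue_iff_isRoot_charpoly] at hz
    obtain ⟨v, hv⟩ := hz.exists_hasEigenvector
    exact SmallOscillations.re_nonneg_of_eigenvector
      (SmallOscillations.isHermitian_map_ofReal hA) (SmallOscillations.posSemidef_map_ofReal hL)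
      hv.2 hv.apply_eq_smul
  · exact SmallOscillations.le_imagAxisCount hq hA hL
      (fun _ => SmallOscillations.arrayStiffness_mulVec_mem_syncSpace hRdiag)
      (fun _ => SmallOscillations.couplingLap_mulVec_of_mem_syncSpace hDdiag)
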